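/- Let $\mathcal C$ be an abelian category and let $(\mathcal T,\mathcal F)$ be a torsion pair in $\mathcal C$, i.e. $\mathcal T,\mathcal F$ are full subcategories (closed under isomorphism) with $\operatorname{Hom}(T,F)=0$ for all $T\in\mathcal T$, $F\in\mathcal F$, and every object $X$ of $\mathcal C$ fits into a short exact sequence $0\to T\to X\to F\to 0$ with $T\in\mathcal T$, $F\in\mathcal F$. Let ${}^p\mathcal C$ be the tilt of $\mathcal C$ with respect to $(\mathcal T,\mathcal F)$, i.e. the (abelian) heart of the $t$-structure on $D^b(\mathcal C)$ given by $${}^pD^{b}(\mathcal C)^{\le 0}=\{X : H^i(X)=0 \text{ for } i>1,\ H^1(X)\in\mathcal T\},\qquad {}^pD^{b}(\mathcal C)^{\ge 0}=\{X : H^i(X)=0 \text{ for } i<0,\ H^0(X)\in\mathcal F\}.$$ Note that $\mathcal F$, placed in degree $0$, is a full subcategory of ${}^p\mathcal C$. Assume that $(\mathcal T,\mathcal F)$ is cotilting, i.e. every object of $\mathcal C$ is a quotient of an object of $\mathcal F$. Then there is an equivalence of triangulated categories $$\Phi: D({}^p\mathcal C)\xrightarrow{\ \sim\ } D(\mathcal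 C)$$ between the unbounded derived categories, which is the identity on complexes over $\mathcal F$: if a complex $K$ over $\mathcal F$ is regarded as a complex over ${}^p\mathcal C$ and as a complex over $\mathcal C$, then $\Phi(K)\cong K$, naturally in $K$. Moreover $\Phi$ restricts to an equivalence of triangulated categories $D^b({}^p\mathcal C)\xrightarrow{\sim} D^b(\mathcal C)$ between the bounded derived categories. -/

import Mathlib

open CategoryTheory Limits Pretriangulated Triangulated ZeroObject

universe w' w v u

namespace CategoryTheory.Triangulated.TStructure

section HeartAbelian

variable {D : Type*} [Category* D] [Preadditive D] [HasZeroObject D] [HasShift D ℤ]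
  [∀ n : ℤ, (shiftFunctor D n).Additive] [Pretriangulated D] (t : TStructure D)

lemma heart_hom_shift_eq_zero ⦃X Y : t.heart.FullSubcategory⦄ ⦃n : ℤ⦄
    (f : t.heart.ι.obj X ⟶ (t.heart.ι.obj Y)⟦n⟧) (hn : n < 0) : f = 0 := by
  have := ((t.mem_heart_iff _).1 X.property).1
  have := ((t.mem_heart_iff _).1 Y.property).2
  have : t.IsGE ((t.heart.ι.obj Y)⟦n⟧) (-n) := t.isGE_shift Y.obj 0 n (-n)
  exact t.zero_of_isLE_of_isGE f 0 (-n) (by lia) ‹_› this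

instance heart_containsZero : t.heart.ContainsZero :=
  ⟨0, isZero_zero D, (t.mem_heart_iff _).2 ⟨inferInstance, inferInstance⟩⟩

instance heart_isTriangulatedClosed₂ : t.heart.IsTriangulatedClosed₂ :=
  .mk' (fun T hT h₁ h₃ ↦ by
    rw [mem_heart_iff] at h₁ h₃ ⊢
    exact ⟨t.isLE₂ T hT 0 h₁.1 h₃.1, t.isGE₂ T hT 0 h₁.2 h₃.2⟩)

instance heart_hasFiniteProducts : HasFiniteProducts t.heart.FullSubcategory := by
  have : t.heart.IsClosedUnderBinaryProducts := ⟨by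
    rintro X ⟨p⟩
    have e := p.isLimit.conePointUniqueUpToIso (IsLimit.postcomposeInvEquiv (diagramIsoPair p.diag) _
      |>.symm (prodIsProd (p.diag.obj ⟨.left⟩) (p.diag.obj ⟨.right⟩)))
    exact t.heart.prop_of_iso e.symm (t.heart.ext_of_isTriangulatedClosed₂ _
      (binaryProductTriangle_distinguished _ _) (p.prop_diag_obj _) (p.prop_diag_obj _))⟩
  have : t.heart.IsClosedUnderFiniteProducts := .mk'
  exact ⟨fun n ↦ inferInstance⟩

lemma distTriang_of_iso₁ {A A' X B : D} {f : A ⟶ X} {g : X ⟶ B} {h : B ⟶ A⟦(1 : ℤ)⟧}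
    (hT : Triangle.mk f g h ∈ distTriang D) (e : A' ≅ A) :
    Triangle.mk (e.hom ≫ f) g (h ≫ e.inv⟦(1 : ℤ)⟧') ∈ distTriang D := by
  have key : (h ≫ e.inv⟦(1 : ℤ)⟧') ≫ e.hom⟦(1 : ℤ)⟧' = h := by
    rw [Category.assoc, ← Functor.map_comp, e.inv_hom_id, Functor.map_id, Category.comp_id]
  exact isomorphic_distinguished _ hT _ (Triangle.isoMk _ _ e (Iso.refl _) (Iso.refl _)
    (Category.comp_id _) ((Category.comp_id _).trans (Category.id_comp _).symm)
    (key.trans (Category.id_comp h).symm))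

lemma heart_admissibleMorphism [IsTriangulated D] :
    AbelianSubcategory.admissibleMorphism t.heart.ι = ⊤ := by
  ext X₁ X₂ f
  simp only [MorphismProperty.top_apply, iff_true]
  intro X₃ f₂ f₃ hT
  have h₁ := (t.mem_heart_iff _).1 X₁.property
  have h₂ := (t.mem_heart_iff _).1 X₂.property
  have := h₁.1; have := h₁.2; have := h₂.1; have := h₂.2
  have l₁ : t.IsLE (X₁.obj⟦(1 : ℤ)⟧) 0 := by
    have : t.IsLE (X₁.obj⟦(1 : ℤ)⟧) (-1) := t.isLE_shift X₁.obj 0 1 (-1)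
    exact t.isLE_of_le _ (-1) 0
  have g₁ : t.IsGE (X₁.obj⟦(1 : ℤ)⟧) (-1) := t.isGE_shift X₁.obj 0 1 (-1)
  have hL : t.IsLE X₃ 0 := t.isLE₂ _ (rot_of_distTriang _ hT) 0 h₂.1 l₁
  have hG : t.IsGE X₃ (-1) :=
    t.isGE₂ _ (rot_of_distTriang _ hT) (-1) (t.isGE_of_ge X₂.obj (-1) 0) g₁
  have k₁ : t.IsLE (((t.truncLE (-1)).obj X₃)⟦(-1 : ℤ)⟧) 0 := t.isLE_shift _ (-1) (-1) 0
  have k₂ : t.IsGE (((t.truncLE (-1)).obj X₃)⟦(-1 : ℤ)⟧) 0 := t.isGE_shift _ (-1) (-1) 0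
  let K : t.heart.FullSubcategory := ⟨_, (t.mem_heart_iff _).2 ⟨k₁, k₂⟩⟩
  let Q : t.heart.FullSubcategory :=
    ⟨(t.truncGE 0).obj X₃, (t.mem_heart_iff _).2 ⟨inferInstance, inferInstance⟩⟩
  let e : (t.heart.ι.obj K)⟦(1 : ℤ)⟧ ≅ (t.truncLE (-1)).obj X₃ :=
    (shiftEquiv D (1 : ℤ)).counitIso.app ((t.truncLE (-1)).obj X₃)
  exact ⟨K, Q, _, _, _, distTriang_of_iso₁
    (t.triangleLEGE_distinguished (-1) 0 (by lia) X₃) e⟩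

/-- The heart of a t-structure on a triangulated category is an abelian category. -/
noncomputable instance heart_abelian [IsTriangulated D] : Abelian t.heart.FullSubcategory :=
  AbelianSubcategory.abelian t.heart.ι t.heart_hom_shift_eq_zero t.heart_admissibleMorphism

end HeartAbelian

end CategoryTheory.Triangulated.TStructure

/-- A torsion pair `(𝒯, ℱ)` in an abelian category `C`: two full subcategories (as usual, closed
under isomorphisms), with no nonzero morphism from an object of `𝒯` to an object of `ℱ`, such that
every object `X` sits in a short exact sequence `0 ⟶ T ⟶ X ⟶ F ⟶ 0` with `T` in `𝒯` and
`F` in `ℱ`. (The vanishing of morphisms makes this sequence unique up to a unique isomorphism.) -/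
structure TorsionPair (C : Type u) [Category.{v} C] [Abelian C] where
  /-- the torsion class `𝒯` -/
  tors : ObjectProperty C
  /-- the torsion-free class `ℱ` -/
  free : ObjectProperty C
  tors_iso : tors.IsClosedUnderIsomorphisms
  free_iso : free.IsClosedUnderIsomorphisms
  hom_eq_zero ⦃T F : C⦄ (hT : tors T) (hF : free F) (f : T ⟶ F) : f = 0
  exists_shortExact (X : C) : ∃ (S : ShortComplex C) (_ : S.X₂ ≅ X),
    S.ShortExact ∧ tors S.X₁ ∧ free S.X₃

namespace TorsionPair

variable {C : Type u} [Category.{v} C] [Abelian C] (τ : TorsionPair C)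

instance : τ.tors.IsClosedUnderIsomorphisms := τ.tors_iso

instance : τ.free.IsClosedUnderIsomorphisms := τ.free_iso

/-- The torsion pair is cotilting: every object of `C` is a quotient of a torsion-free object. -/
def IsCotilting : Prop :=
  ∀ X : C, ∃ (F : C) (_ : τ.free F) (p : F ⟶ X), Epi p

lemma tors_of_isZero {X : C} (hX : IsZero X) : τ.tors X := by
  obtain ⟨S, e, hS, h₁, -⟩ := τ.exists_shortExact X
  have := hS.mono_f
  have h : IsZero S.X₁ := IsZero.of_mono S.f (hX.of_iso e)
  exact τ.tors.prop_of_iso (h.iso hX) h₁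

lemma free_of_isZero {X : C} (hX : IsZero X) : τ.free X := by
  obtain ⟨S, e, hS, -, h₃⟩ := τ.exists_shortExact X
  have := hS.epi_g
  have h : IsZero S.X₃ := IsZero.of_epi S.g (hX.of_iso e)
  exact τ.free.prop_of_iso (h.iso hX) h₃

variable [HasDerivedCategory.{w} C]

open DerivedCategory

/-- Objects `X` of `D(C)` with `Hⁱ(X) = 0` for `i > n + 1` and `Hⁿ⁺¹(X)` torsion. -/
def le (n : ℤ) : ObjectProperty (DerivedCategory C) := fun X ↦
  (∀ i : ℤ, n + 1 < i → IsZero ((homologyFunctor C i).obj X)) ∧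
    τ.tors ((homologyFunctor C (n + 1)).obj X)

/-- Objects `X` of `D(C)` with `Hⁱ(X) = 0` for `i < n` and `Hⁿ(X)` torsion-free. -/
def ge (n : ℤ) : ObjectProperty (DerivedCategory C) := fun X ↦
  (∀ i : ℤ, i < n → IsZero ((homologyFunctor C i).obj X)) ∧
    τ.free ((homologyFunctor C n).obj X)

instance (n : ℤ) : (τ.le n).IsClosedUnderIsomorphisms where
  of_iso e h := ⟨fun i hi ↦ (h.1 i hi).of_iso ((homologyFunctor C i).mapIso e.symm),
    τ.tors.prop_of_iso ((homologyFunctor C _).mapIso e) h.2⟩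

instance (n : ℤ) : (τ.ge n).IsClosedUnderIsomorphisms where
  of_iso e h := ⟨fun i hi ↦ (h.1 i hi).of_iso ((homologyFunctor C i).mapIso e.symm),
    τ.free.prop_of_iso ((homologyFunctor C _).mapIso e) h.2⟩

/-- `Hⁱ(X⟦a⟧) ≅ Hⁱ⁺ᵃ(X)` -/
noncomputable def homologyShiftIso (X : DerivedCategory C) (a i j : ℤ) (h : a + i = j) :
    (homologyFunctor C i).obj (X⟦a⟧) ≅ (homologyFunctor C j).obj X :=
  ((homologyFunctor C 0).shiftIso a i j h).app X

lemma le_shift (n a n' : ℤ) (h : a + n' = n) (X : DerivedCategory C) (hX : τ.le n X) :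
    τ.le n' (X⟦a⟧) :=
  ⟨fun i hi ↦ (hX.1 (a + i) (by lia)).of_iso (homologyShiftIso X a i _ rfl),
    τ.tors.prop_of_iso (homologyShiftIso X a (n' + 1) (n + 1) (by lia)).symm hX.2⟩

lemma ge_shift (n a n' : ℤ) (h : a + n' = n) (X : DerivedCategory C) (hX : τ.ge n X) :
    τ.ge n' (X⟦a⟧) :=
  ⟨fun i hi ↦ (hX.1 (a + i) (by lia)).of_iso (homologyShiftIso X a i _ rfl),
    τ.free.prop_of_iso (homologyShiftIso X a n' n (by lia)).symm hX.2⟩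

lemma isLE_of_le {n : ℤ} {X : DerivedCategory C} (h : τ.le n X) : X.IsLE (n + 1) :=
  (isLE_iff _ _).2 h.1

lemma isGE_of_ge {n : ℤ} {X : DerivedCategory C} (h : τ.ge n X) : X.IsGE n :=
  (isGE_iff _ _).2 h.1

lemma le_of_isLE {n : ℤ} {X : DerivedCategory C} (h : X.IsLE n) : τ.le n X :=
  ⟨fun i hi ↦ X.isZero_of_isLE n i (by lia), τ.tors_of_isZero (X.isZero_of_isLE n _ (by lia))⟩

lemma ge_of_isGE {n m : ℤ} {X : DerivedCategory C} (h : X.IsGE m) (hnm : n < m) : τ.ge n X :=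
  ⟨fun i hi ↦ X.isZero_of_isGE m i (by lia), τ.free_of_isZero (X.isZero_of_isGE m _ (by lia))⟩

lemma le_single {n m : ℤ} (h : n + 1 = m) {T : C} (hT : τ.tors T) :
    τ.le n ((singleFunctor C m).obj T) := by
  subst h
  exact ⟨fun i hi ↦ isZero_of_isLE _ (n + 1) i hi,
    τ.tors.prop_of_iso ((singleFunctorCompHomologyFunctorIso C (n + 1)).app T).symm hT⟩

lemma ge_single {n : ℤ} {F : C} (hF : τ.free F) : τ.ge n ((singleFunctor C n).obj F) :=
  ⟨fun i hi ↦ isZero_of_isGE _ n i hi,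
    τ.free.prop_of_iso ((singleFunctorCompHomologyFunctorIso C n).app F).symm hF⟩

lemma le_of_distTriang (T : Triangle (DerivedCategory C)) (hT : T ∈ distTriang _) (n : ℤ)
    (h₁ : T.obj₁.IsLE n) (h₃ : τ.le n T.obj₃) : τ.le n T.obj₂ := by
  have h₁' : T.obj₁.IsLE (n + 1) := TStructure.t.isLE_of_le _ n (n + 1)
  have h₂ : T.obj₂.IsLE (n + 1) := TStructure.t.isLE₂ T hT _ h₁' (τ.isLE_of_le h₃)
  refine ⟨(isLE_iff _ _).1 h₂, ?_⟩
  have z := T.obj₁.isZero_of_isLE n (n + 1) (by lia)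
  have z' := T.obj₁.isZero_of_isLE n (n + 1 + 1) (by lia)
  have : Mono ((homologyFunctor C (n + 1)).map T.mor₂) :=
    (HomologySequence.mono_homologyMap_mor₂_iff T hT _).2 (z.eq_of_src _ _)
  have : Epi ((homologyFunctor C (n + 1)).map T.mor₂) :=
    (HomologySequence.epi_homologyMap_mor₂_iff T hT _ (n + 1 + 1) rfl).2 (z'.eq_of_tgt _ _)
  have := isIso_of_mono_of_epi ((homologyFunctor C (n + 1)).map T.mor₂)
  exact τ.tors.prop_of_iso (asIso ((homologyFunctor C (n + 1)).map T.mor₂)).symm h₃.2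

lemma ge_of_distTriang (T : Triangle (DerivedCategory C)) (hT : T ∈ distTriang _) (n m : ℤ)
    (hnm : n < m) (h₁ : τ.ge n T.obj₁) (h₃ : T.obj₃.IsGE m) : τ.ge n T.obj₂ := by
  have h₃' : T.obj₃.IsGE n := TStructure.t.isGE_of_ge _ n m
  have h₂ : T.obj₂.IsGE n := TStructure.t.isGE₂ T hT _ (τ.isGE_of_ge h₁) h₃'
  refine ⟨(isGE_iff _ _).1 h₂, ?_⟩
  have z := T.obj₃.isZero_of_isGE m n (by lia)
  have z' := T.obj₃.isZero_of_isGE m (n - 1) (by lia)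
  have : Epi ((homologyFunctor C n).map T.mor₁) :=
    (HomologySequence.epi_homologyMap_mor₁_iff T hT _).2 (z.eq_of_tgt _ _)
  have : Mono ((homologyFunctor C n).map T.mor₁) :=
    (HomologySequence.mono_homologyMap_mor₁_iff T hT (n - 1) n (by lia)).2 (z'.eq_of_src _ _)
  have := isIso_of_mono_of_epi ((homologyFunctor C n).map T.mor₁)
  exact τ.free.prop_of_iso (asIso ((homologyFunctor C n).map T.mor₁)) h₁.2

lemma exists_iso_single_of_le {n m : ℤ} (h : n + 1 = m) {X : DerivedCategory C} (hX : τ.le n X)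
    (hX' : X.IsGE m) : ∃ (T : C) (_ : τ.tors T), Nonempty (X ≅ (singleFunctor C m).obj T) := by
  subst h
  have := τ.isLE_of_le hX
  obtain ⟨T, ⟨e⟩⟩ := X.exists_iso_singleFunctor_obj_of_isGE_of_isLE (n + 1)
  exact ⟨T, τ.tors.prop_of_iso ((homologyFunctor C (n + 1)).mapIso e ≪≫
    (singleFunctorCompHomologyFunctorIso C (n + 1)).app T) hX.2, ⟨e⟩⟩

lemma exists_iso_single_of_ge {n : ℤ} {X : DerivedCategory C} (hX : τ.ge n X)
    (hX' : X.IsLE n) : ∃ (F : C) (_ : τ.free F), Nonempty (X ≅ (singleFunctor C n).obj F) := by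
  have := τ.isGE_of_ge hX
  obtain ⟨F, ⟨e⟩⟩ := X.exists_iso_singleFunctor_obj_of_isGE_of_isLE n
  exact ⟨F, τ.free.prop_of_iso ((homologyFunctor C n).mapIso e ≪≫
    (singleFunctorCompHomologyFunctorIso C n).app F) hX.2, ⟨e⟩⟩

lemma le_truncGE {n m : ℤ} (h : n + 1 = m) {X : DerivedCategory C} (hX : τ.le n X) :
    τ.le n ((TStructure.t.truncGE m).obj X) := by
  subst h
  have := τ.isLE_of_le hX
  refine ⟨(isLE_iff _ _).1 inferInstance, ?_⟩
  have hT := TStructure.t.triangleLEGE_distinguished n (n + 1) rfl X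
  let T := (TStructure.t.triangleLEGE n (n + 1) rfl).obj X
  have h₁ : T.obj₁.IsLE n := inferInstanceAs (((TStructure.t.truncLE n).obj X).IsLE n)
  have z := T.obj₁.isZero_of_isLE n (n + 1) (by lia)
  have z' := T.obj₁.isZero_of_isLE n (n + 1 + 1) (by lia)
  have : Mono ((homologyFunctor C (n + 1)).map T.mor₂) :=
    (HomologySequence.mono_homologyMap_mor₂_iff T hT _).2 (z.eq_of_src _ _)
  have : Epi ((homologyFunctor C (n + 1)).map T.mor₂) :=
    (HomologySequence.epi_homologyMap_mor₂_iff T hT _ (n + 1 + 1) rfl).2 (z'.eq_of_tgt _ _)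
  have := isIso_of_mono_of_epi ((homologyFunctor C (n + 1)).map T.mor₂)
  exact τ.tors.prop_of_iso
    (@asIso _ _ _ _ ((homologyFunctor C (n + 1)).map T.mor₂) this) hX.2

lemma ge_truncLE {n : ℤ} {X : DerivedCategory C} (hX : τ.ge n X) :
    τ.ge n ((TStructure.t.truncLE n).obj X) := by
  have := τ.isGE_of_ge hX
  refine ⟨(isGE_iff _ _).1 inferInstance, ?_⟩
  have hT := TStructure.t.triangleLEGE_distinguished n (n + 1) rfl X
  let T := (TStructure.t.triangleLEGE n (n + 1) rfl).obj X
  have h₁ : T.obj₃.IsGE (n + 1) :=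
    inferInstanceAs (((TStructure.t.truncGE (n + 1)).obj X).IsGE (n + 1))
  have z := T.obj₃.isZero_of_isGE (n + 1) n (by lia)
  have z' := T.obj₃.isZero_of_isGE (n + 1) (n - 1) (by lia)
  have : Epi ((homologyFunctor C n).map T.mor₁) :=
    (HomologySequence.epi_homologyMap_mor₁_iff T hT _).2 (z.eq_of_tgt _ _)
  have : Mono ((homologyFunctor C n).map T.mor₁) :=
    (HomologySequence.mono_homologyMap_mor₁_iff T hT (n - 1) n (by lia)).2 (z'.eq_of_src _ _)
  have := isIso_of_mono_of_epi ((homologyFunctor C n).map T.mor₁)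
  exact τ.free.prop_of_iso (asIso ((homologyFunctor C n).map T.mor₁)).symm hX.2

lemma hom_eq_zero_of_le_of_ge ⦃X Y : DerivedCategory C⦄ (f : X ⟶ Y) (hX : τ.le 0 X)
    (hY : τ.ge 1 Y) : f = 0 := by
  have hX' : X.IsLE 1 := τ.isLE_of_le hX
  have hY' : Y.IsGE 1 := τ.isGE_of_ge hY
  obtain ⟨f, rfl⟩ : ∃ f', f = (TStructure.t.truncGEπ 1).app X ≫ f' :=
    ⟨_, (TStructure.t.π_descTruncGE f 1).symm⟩
  obtain ⟨f, rfl⟩ : ∃ f', f = f' ≫ (TStructure.t.truncLEι 1).app Y :=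
    ⟨_, (TStructure.t.liftTruncLE_ι f 1).symm⟩
  obtain ⟨T, hT, ⟨e⟩⟩ := τ.exists_iso_single_of_le (zero_add 1) (τ.le_truncGE (zero_add 1) hX)
    inferInstance
  obtain ⟨F, hF, ⟨e'⟩⟩ := τ.exists_iso_single_of_ge (τ.ge_truncLE hY) inferInstance
  obtain ⟨g, hg⟩ := (singleFunctor C 1).map_surjective (e.inv ≫ f ≫ e'.hom)
  have : f = 0 := by
    rw [τ.hom_eq_zero hT hF g, Functor.map_zero] at hg
    rw [← cancel_epi e.inv, ← cancel_mono e'.hom, Category.assoc, ← hg, comp_zero, zero_comp]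
  rw [this, zero_comp, comp_zero]

/-- The distinguished triangle with vertices `S.X₁[-n]`, `S.X₂[-n]`, `S.X₃[-n]` given by a short
exact sequence `S`. -/
lemma exists_single_distTriang {S : ShortComplex C} (hS : S.ShortExact) (n : ℤ) :
    ∃ (f : (singleFunctor C n).obj S.X₁ ⟶ (singleFunctor C n).obj S.X₂)
      (g : (singleFunctor C n).obj S.X₂ ⟶ (singleFunctor C n).obj S.X₃)
      (h : (singleFunctor C n).obj S.X₃ ⟶ ((singleFunctor C n).obj S.X₁)⟦(1 : ℤ)⟧),
      Triangle.mk f g h ∈ distTriang _ :=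
  ⟨_, _, _, triangleOfSES_distinguished
    (hS.map_of_exact (HomologicalComplex.single C (ComplexShape.up ℤ) n))⟩

lemma exists_triangle (A : DerivedCategory C) :
    ∃ (X Y : DerivedCategory C) (_ : τ.le 0 X) (_ : τ.ge 1 Y) (f : X ⟶ A) (g : A ⟶ Y)
      (h : Y ⟶ X⟦(1 : ℤ)⟧), Triangle.mk f g h ∈ distTriang _ := by
  -- `M` is `τ^{≥ 1} A` and `L` is `τ^{≤ 1} τ^{≥ 1} A`
  let M := (TStructure.t.truncGE 1).obj A
  let L := (TStructure.t.truncLE 1).obj M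
  obtain ⟨B, ⟨e⟩⟩ := L.exists_iso_singleFunctor_obj_of_isGE_of_isLE 1
  obtain ⟨S, e', hS, hT, hF⟩ := τ.exists_shortExact B
  obtain ⟨a, b, c, habc⟩ := exists_single_distTriang hS 1
  let i : (singleFunctor C 1).obj S.X₂ ≅ L := (singleFunctor C 1).mapIso e' ≪≫ e.symm
  have h₂ := TStructure.distTriang_of_iso₁ (TStructure.t.triangleLEGE_distinguished 1 2 rfl M) i
  obtain ⟨Y, p, q, hY⟩ := distinguished_cocone_triangle
    (a ≫ i.hom ≫ (TStructure.t.truncLEι 1).app M)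
  have hYge : τ.ge 1 Y := τ.ge_of_distTriang _ (someOctahedron rfl habc h₂ hY).mem 1 2 (by lia)
    (τ.ge_single hF) (inferInstanceAs (((TStructure.t.truncGE 2).obj M).IsGE 2))
  obtain ⟨X, r, s, hX⟩ := distinguished_cocone_triangle₁ ((TStructure.t.truncGEπ 1).app A ≫ p)
  have oct := someOctahedron rfl
    (rot_of_distTriang _ (TStructure.t.triangleLEGE_distinguished 0 1 rfl A))
    (rot_of_distTriang _ hY) (rot_of_distTriang _ hX)
  have hX₁ : τ.le (-1) (X⟦(1 : ℤ)⟧) := τ.le_of_distTriang _ oct.mem (-1)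
    (TStructure.t.isLE_shift ((TStructure.t.truncLE 0).obj A) 0 1 (-1))
    (τ.le_shift 0 1 (-1) (by lia) _ (τ.le_single (by lia) hT))
  have hXle : τ.le 0 X := (τ.le 0).prop_of_iso ((shiftEquiv _ (1 : ℤ)).unitIso.app X).symm
    (τ.le_shift (-1) (-1) 0 (by lia) _ hX₁)
  exact ⟨X, Y, hXle, hYge, r, _, s, hX⟩

/-- The t-structure on `D(C)` attached to a torsion pair. -/
noncomputable def tStructure : TStructure (DerivedCategory C) where
  le := τ.le
  ge := τ.ge
  le_shift := τ.le_shift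
  ge_shift := τ.ge_shift
  zero' := τ.hom_eq_zero_of_le_of_ge
  le_zero_le _ hX := τ.le_of_isLE (τ.isLE_of_le hX)
  ge_one_le _ hX := τ.ge_of_isGE (τ.isGE_of_ge hX) (by lia)
  exists_triangle_zero_one := τ.exists_triangle

instance : (TStructure.t (C := C)).bounded.HasInducedTStructure τ.tStructure where
  exists_triangle_zero_one A hA := by
    obtain ⟨X, Y, hX, hY, f, g, h, hT⟩ := τ.exists_triangle A
    have hX' : X.IsLE 1 := τ.isLE_of_le hX
    have hY' : Y.IsGE 1 := τ.isGE_of_ge hY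
    obtain ⟨⟨a, ha⟩, ⟨b, hb⟩⟩ := hA
    have hYp : TStructure.t.plus Y := ⟨1, hY'⟩
    have hXp : TStructure.t.plus X :=
      TStructure.t.plus.ext_of_isTriangulatedClosed₁ _ hT ⟨a, ha⟩ hYp
    have hXm : TStructure.t.minus X := ⟨1, hX'⟩
    have hYm : TStructure.t.minus Y :=
      TStructure.t.minus.ext_of_isTriangulatedClosed₃ _ hT hXm ⟨b, hb⟩
    exact ⟨X, Y, ⟨hX⟩, ⟨hY⟩, f, g, h, hT,
      ObjectProperty.le_isoClosure _ _ ⟨hXp, hXm⟩, ObjectProperty.le_isoClosure _ _ ⟨hYp, hYm⟩⟩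

/-- The t-structure on `Dᵇ(C)` attached to a torsion pair `(𝒯, ℱ)`: `X` is `≤ 0` if `Hⁱ(X) = 0`
for `i > 1` and `H¹(X) ∈ 𝒯`, and `X` is `≥ 0` if `Hⁱ(X) = 0` for `i < 0` and `H⁰(X) ∈ ℱ`. -/
noncomputable def boundedTStructure : TStructure (Bounded C) :=
  (TStructure.t (C := C)).bounded.tStructure τ.tStructure

lemma boundedTStructure_le_zero_iff (X : Bounded C) :
    τ.boundedTStructure.le 0 X ↔
      X.obj.IsLE 1 ∧ τ.tors ((homologyFunctor C 1).obj X.obj) := by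
  rw [isLE_iff]
  exact Iff.rfl

lemma boundedTStructure_ge_zero_iff (X : Bounded C) :
    τ.boundedTStructure.ge 0 X ↔
      X.obj.IsGE 0 ∧ τ.free ((homologyFunctor C 0).obj X.obj) := by
  rw [isGE_iff]
  exact Iff.rfl

/-- The tilt `ᵖC` of `C` with respect to a torsion pair: the heart of the t-structure
`boundedTStructure` on `Dᵇ(C)`, an abelian category by `TStructure.heart_abelian`. -/
abbrev Tilt : Type (max u v) := τ.boundedTStructure.heart.FullSubcategory

lemma bounded_single (X : C) :
    (TStructure.t (C := C)).bounded ((singleFunctor C 0).obj X) :=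
  ⟨⟨0, inferInstance⟩, ⟨0, inferInstance⟩⟩

lemma heart_single {F : C} (hF : τ.free F) :
    τ.boundedTStructure.heart (⟨(singleFunctor C 0).obj F, bounded_single F⟩ : Bounded C) :=
  ⟨τ.le_of_isLE (n := 0) (X := (singleFunctor C 0).obj F) inferInstance, τ.ge_single hF⟩

/-- The inclusion `ℱ ⥤ ᵖC`, which sends `F` to the complex `F` placed in degree `0`. -/
noncomputable def freeToTilt : τ.free.FullSubcategory ⥤ τ.Tilt :=
  τ.boundedTStructure.heart.lift
    ((TStructure.t (C := C)).bounded.lift (τ.free.ι ⋙ singleFunctor C 0)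
      (fun F ↦ bounded_single F.obj))
    (fun F ↦ τ.heart_single F.property)

instance : τ.freeToTilt.Additive where
  map_add {X Y f g} := by
    apply τ.boundedTStructure.heart.ι.map_injective
    apply (TStructure.t (C := C)).bounded.ι.map_injective
    exact (singleFunctor C 0).map_add

end TorsionPair

/-!
The class `ℱ` generates `C` and is closed under subobjects in `C`; dually, every object of the
tilt embeds into an object of `ℱ`, and `ℱ` is closed under quotients in the tilt. Hence each
complex over `C` receives a quasi-isomorphism from a complex over `ℱ`, each complex over the tilt
maps by one to a complex over `ℱ`, and both derived categories are Verdier quotients of the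
homotopy category of `ℱ`. A complex over `ℱ` is acyclic in either abelian category if and only if
it splits into short exact sequences with terms in `ℱ`. A sequence in `ℱ` is short exact in `C`
if and only if it is short exact in the tilt, both meaning that it extends to a distinguished
triangle of `D(C)`. So the two quotients are by the same acyclic complexes. Either bounded
derived category is the triangulated subcategory generated by `ℱ` in degree `0`, so the
equivalence restricts.
-/

section Localization

variable {T K D : Type*} [Category* T] [Category* K] [Category* D]
  [HasZeroObject T] [HasShift T ℤ] [Preadditive T]
  [∀ n : ℤ, (shiftFunctor T n).Additive] [Pretriangulated T]
  [HasZeroObject K] [HasShift K ℤ] [Preadditive K]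
  [∀ n : ℤ, (shiftFunctor K n).Additive] [Pretriangulated K]
  (A B : ObjectProperty K)
  (j : T ⥤ K) [j.CommShift ℤ] [j.IsTriangulated] [j.Full] [j.Faithful] (L : K ⥤ D)

variable {A B} in
lemma exists_trW_of_distTriang [IsTriangulated K] [A.IsTriangulated]
    [A.IsClosedUnderIsomorphisms] [B.IsTriangulated] {X I Y Q : K} {f : X ⟶ I} {g : I ⟶ Y}
    {h : Y ⟶ X⟦(1 : ℤ)⟧} (hT : Triangle.mk f g h ∈ distTriang K) (hI : A I)
    {s : Y ⟶ Q} (hs : B.trW s) (hQ : A Q) :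
    ∃ (Z : K) (t : X ⟶ Z), A Z ∧ B.trW t := by
  obtain ⟨Z, i, δ, hT'⟩ := distinguished_cocone_triangle₁ (g ≫ s)
  obtain ⟨t', ht', -⟩ := MorphismProperty.compatible_with_triangulation (W := B.trW) _ _
    (rot_of_distTriang _ hT) (rot_of_distTriang _ hT') (𝟙 I) s
    (MorphismProperty.id_mem _ _) hs (Category.id_comp _).symm
  obtain ⟨t, rfl⟩ := (shiftFunctor K (1 : ℤ)).map_surjective t'
  exact ⟨Z, t, A.ext_of_isTriangulatedClosed₁ _ hT' hI hQ,
    (MorphismProperty.IsCompatibleWithShift.iff _ t (1 : ℤ)).1 ht'⟩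

variable [B.IsClosedUnderIsomorphisms]

lemma trW_inf_of_prop [A.IsTriangulated] {X Y : K} {s : X ⟶ Y} (hs : B.trW s) (hX : A X)
    (hY : A Y) : (A ⊓ B).trW s :=
  (ObjectProperty.trW_inverseImage_ι_iff A B (X := ⟨X, hX⟩) (Y := ⟨Y, hY⟩) (A.homMk s)).1
    ((B.inverseImage_trW_iff A.ι _).2 hs)

lemma isLocalization_comp_of_isLocalizedFullyFaithful
    [L.IsLocalization B.trW]
    [(j.essImage.triangulatedLocalizerMorphism B).IsLocalizedFullyFaithful]
    [(j ⋙ L).EssSurj] :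
    (j ⋙ L).IsLocalization (B.inverseImage j).trW := by
  have : (j.essImage.ι ⋙ L).EssSurj := ⟨fun Y ↦
    ⟨j.toEssImage.obj ((j ⋙ L).objPreimage Y), ⟨(j ⋙ L).objObjPreimageIso Y⟩⟩⟩
  have : (j.essImage.ι ⋙ L).IsLocalization (B.inverseImage j.essImage.ι).trW :=
    (j.essImage.triangulatedLocalizerMorphism B).isLocalization_of_isLocalizedFullyFaithful
      (F := 𝟭 D) (Functor.rightUnitor _).symm
  let e := Functor.isoWhiskerRight j.toEssImage.asEquivalence.counitIso j.essImage.ι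
  refine Functor.IsLocalization.of_equivalence_source (j.essImage.ι ⋙ L)
    (B.inverseImage j.essImage.ι).trW _ _ j.toEssImage.asEquivalence.symm (fun X Y f hf ↦ ?_)
    (B.inverseImage_trW_isInverted j L) (Functor.isoWhiskerRight e L)
  refine MorphismProperty.le_isoClosure _ _ ?_
  rw [ObjectProperty.inverseImage_trW_iff] at hf ⊢
  exact (MorphismProperty.arrow_mk_iso_iff _ (Arrow.isoOfNatIso e (Arrow.mk f)).symm).1 hf

variable [IsTriangulated K] [B.IsTriangulated]

lemma isVerdierLeftLocalizing_of_exists_trW [A.IsTriangulated]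
    (h : ∀ X : K, ∃ (Z : K) (s : Z ⟶ X), A Z ∧ B.trW s) : A.IsVerdierLeftLocalizing B := by
  rw [ObjectProperty.isVerdierLeftLocalizing_iff]
  intro X Y s hY hs
  obtain ⟨Z, t, hZ, ht⟩ := h X
  exact ⟨Z, t ≫ s, t, hZ, trW_inf_of_prop _ _ (MorphismProperty.comp_mem _ _ _ ht hs) hZ hY, rfl⟩

lemma isVerdierRightLocalizing_of_exists_trW [A.IsTriangulated]
    (h : ∀ X : K, ∃ (Z : K) (s : X ⟶ Z), A Z ∧ B.trW s) : A.IsVerdierRightLocalizing B := by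
  rw [ObjectProperty.isVerdierRightLocalizing_iff]
  intro X Y s hX hs
  obtain ⟨Z, t, hZ, ht⟩ := h Y
  exact ⟨Z, s ≫ t, t, hZ, trW_inf_of_prop _ _ (MorphismProperty.comp_mem _ _ _ hs ht) hX hZ, rfl⟩

variable [L.IsLocalization B.trW]

lemma isLocalization_comp_of_exists_trW_to
    (h : ∀ X : K, ∃ (Z : T) (s : j.obj Z ⟶ X), B.trW s) :
    (j ⋙ L).IsLocalization (B.inverseImage j).trW := by
  have := isVerdierLeftLocalizing_of_exists_trW j.essImage B fun X ↦ by
    obtain ⟨Z, s, hs⟩ := h X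
    exact ⟨j.obj Z, s, j.obj_mem_essImage Z, hs⟩
  have := Localization.essSurj L B.trW
  have : (j ⋙ L).EssSurj := ⟨fun Y ↦ by
    obtain ⟨Z, s, hs⟩ := h (L.objPreimage Y)
    have := Localization.inverts L B.trW s hs
    exact ⟨Z, ⟨asIso (L.map s) ≪≫ L.objObjPreimageIso Y⟩⟩⟩
  exact isLocalization_comp_of_isLocalizedFullyFaithful B j L

lemma isLocalization_comp_of_exists_trW_from
    (h : ∀ X : K, ∃ (Z : T) (s : X ⟶ j.obj Z), B.trW s) :
    (j ⋙ L).IsLocalization (B.inverseImage j).trW := by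
  have := isVerdierRightLocalizing_of_exists_trW j.essImage B fun X ↦ by
    obtain ⟨Z, s, hs⟩ := h X
    exact ⟨j.obj Z, s, j.obj_mem_essImage Z, hs⟩
  have := Localization.essSurj L B.trW
  have : (j ⋙ L).EssSurj := ⟨fun Y ↦ by
    obtain ⟨Z, s, hs⟩ := h (L.objPreimage Y)
    have := Localization.inverts L B.trW s hs
    exact ⟨Z, ⟨(asIso (L.map s)).symm ≪≫ L.objObjPreimageIso Y⟩⟩⟩
  exact isLocalization_comp_of_isLocalizedFullyFaithful B j L

end Localization

section Equivalence

variable {T D₁ D₂ : Type*} [Category* T] [Category* D₁] [Category* D₂]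
  [HasZeroObject T] [HasShift T ℤ] [Preadditive T]
  [∀ n : ℤ, (shiftFunctor T n).Additive] [Pretriangulated T] [IsTriangulated T]
  [HasZeroObject D₁] [HasShift D₁ ℤ] [Preadditive D₁]
  [∀ n : ℤ, (shiftFunctor D₁ n).Additive] [Pretriangulated D₁]
  [HasZeroObject D₂] [HasShift D₂ ℤ] [Preadditive D₂]
  [∀ n : ℤ, (shiftFunctor D₂ n).Additive] [Pretriangulated D₂]

lemma exists_commShift_isTriangulated_of_lifting (N : ObjectProperty T) [N.IsTriangulated]
    (L₁ : T ⥤ D₁) (L₂ : T ⥤ D₂) [L₁.CommShift ℤ] [L₂.CommShift ℤ]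
    [L₁.IsTriangulated] [L₂.IsTriangulated] [L₁.IsLocalization N.trW]
    (F : D₁ ⥤ D₂) [Localization.Lifting L₁ N.trW L₂ F] :
    ∃ (_ : F.CommShift ℤ), F.IsTriangulated := by
  let := Functor.commShiftOfLocalization L₁ N.trW ℤ L₂ F
  have := Localization.essSurj_mapArrow L₁ N.trW
  exact ⟨inferInstance, Functor.isTriangulated_of_precomp_iso
    (Localization.Lifting.iso L₁ N.trW L₂ F)⟩

lemma exists_triangulated_equivalence_of_isLocalization (N : ObjectProperty T)
    [N.IsTriangulated] (L₁ : T ⥤ D₁) (L₂ : T ⥤ D₂) [L₁.CommShift ℤ] [L₂.CommShift ℤ]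
    [L₁.IsTriangulated] [L₂.IsTriangulated]
    [L₁.IsLocalization N.trW] [L₂.IsLocalization N.trW] :
    ∃ (Φ : D₁ ≌ D₂) (_ : Φ.functor.CommShift ℤ) (_ : Φ.inverse.CommShift ℤ),
      Φ.functor.IsTriangulated ∧ Φ.inverse.IsTriangulated ∧
      Nonempty (L₁ ⋙ Φ.functor ≅ L₂) ∧ Nonempty (L₂ ⋙ Φ.inverse ≅ L₁) := by
  let Φ := Localization.uniq L₁ L₂ N.trW
  obtain ⟨c, hc⟩ := exists_commShift_isTriangulated_of_lifting N L₁ L₂ Φ.functor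
  obtain ⟨c', hc'⟩ := exists_commShift_isTriangulated_of_lifting N L₂ L₁ Φ.inverse
  exact ⟨Φ, c, c', hc, hc', ⟨Localization.compUniqFunctor _ _ _⟩,
    ⟨Localization.compUniqInverse _ _ _⟩⟩

lemma exists_triangulated_restriction (Φ : D₁ ≌ D₂) [Φ.functor.CommShift ℤ]
    [Φ.functor.IsTriangulated] (P₁ : ObjectProperty D₁) (P₂ : ObjectProperty D₂)
    [P₁.IsTriangulated] [P₂.IsTriangulated]
    (h₁ : P₁ ≤ P₂.inverseImage Φ.functor) (h₂ : P₂ ≤ P₁.inverseImage Φ.inverse) :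
    ∃ (Ψ : P₁.FullSubcategory ≌ P₂.FullSubcategory) (_ : Ψ.functor.CommShift ℤ),
      Ψ.functor.IsTriangulated ∧ Nonempty (Ψ.functor ⋙ P₂.ι ≅ P₁.ι ⋙ Φ.functor) := by
  have h (X : P₁.FullSubcategory) : P₂ ((P₁.ι ⋙ Φ.functor).obj X) := h₁ _ X.property
  have : (P₂.lift (P₁.ι ⋙ Φ.functor) h).EssSurj := ⟨fun Y ↦
    ⟨⟨_, h₂ _ Y.property⟩, ⟨P₂.ι.preimageIso (Φ.counitIso.app Y.obj)⟩⟩⟩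
  have : (P₂.lift (P₁.ι ⋙ Φ.functor) h).IsEquivalence := { }
  exact ⟨(P₂.lift (P₁.ι ⋙ Φ.functor) h).asEquivalence,
    (inferInstance : (P₂.lift (P₁.ι ⋙ Φ.functor) h).CommShift ℤ),
    (inferInstance : (P₂.lift (P₁.ι ⋙ Φ.functor) h).IsTriangulated), ⟨P₂.liftCompιIso _ _⟩⟩

end Equivalence

/-- The essential image of `j : E ⥤ A` is closed under subobjects, and every object of `A` is a
quotient of one in it. These are the properties of a cotilting torsion-free class by which complexes
over it compute `D(A)`. -/
structure IsCotiltingEmbedding {E A : Type*} [Category* E] [Category* A] (j : E ⥤ A) : Prop where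
  exists_epi (X : A) : ∃ (F : E) (p : j.obj F ⟶ X), Epi p
  essImage_of_mono ⦃X Y : A⦄ (i : X ⟶ Y) [Mono i] : j.essImage Y → j.essImage X

/-- The essential image of `j : E ⥤ A` is closed under quotients, and every object of `A` is a
subobject of one in it. These are the properties of a tilting torsion class by which complexes over
it compute `D(A)`. -/
structure IsTiltingEmbedding {E A : Type*} [Category* E] [Category* A] (j : E ⥤ A) : Prop where
  exists_mono (X : A) : ∃ (F : E) (i : X ⟶ j.obj F), Mono i
  essImage_of_epi ⦃X Y : A⦄ (p : X ⟶ Y) [Epi p] : j.essImage X → j.essImage Y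

section Resolution

open HomologicalComplex CochainComplex CochainComplex.HomComplex

variable {E A : Type*} [Category* E] [Preadditive E] [Category* A] [Abelian A]
  {j : E ⥤ A} [j.Additive]

lemma essImage_mapHomologicalComplex [j.Full] [j.Faithful] {ι : Type*} {c : ComplexShape ι}
    {X : HomologicalComplex A c} (hX : ∀ i, j.essImage (X.X i)) :
    (j.mapHomologicalComplex c).essImage X :=
  ⟨{ X i := (hX i).witness
     d i k := j.preimage ((hX i).getIso.hom ≫ X.d i k ≫ (hX k).getIso.inv)
     shape i k h := j.map_injective (by simp [X.shape i k h])
     d_comp_d' i k l _ _ := j.map_injective (by simp) },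
   ⟨Hom.isoOfComponents (fun i ↦ (hX i).getIso) (fun i k _ ↦ by
     change _ = j.map (j.preimage _) ≫ _
     rw [j.map_preimage, Category.assoc, Category.assoc, Iso.inv_hom_id, Category.comp_id]
     rfl)⟩⟩

lemma essImage_mapHomotopyCategory_quotient_obj [j.Full] [j.Faithful] {ι : Type*}
    {c : ComplexShape ι} {X : HomologicalComplex A c} (hX : ∀ i, j.essImage (X.X i)) :
    (j.mapHomotopyCategory c).essImage ((HomotopyCategory.quotient A c).obj X) := by
  obtain ⟨K, ⟨e⟩⟩ := essImage_mapHomologicalComplex hX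
  exact ⟨(HomotopyCategory.quotient E c).obj K, ⟨(HomotopyCategory.quotient A c).mapIso e⟩⟩

lemma trW_subcategoryAcyclic_quotient_map {K L : CochainComplex A ℤ} (f : K ⟶ L) [QuasiIso f] :
    (HomotopyCategory.subcategoryAcyclic A).trW ((HomotopyCategory.quotient A _).map f) := by
  rw [← HomotopyCategory.quasiIso_eq_trW_subcategoryAcyclic,
    HomotopyCategory.quotient_map_mem_quasiIso_iff]
  assumption

variable [HasBinaryBiproducts E]

lemma essImage_biprod {X Y : A} (hX : j.essImage X) (hY : j.essImage Y) :
    j.essImage (X ⊞ Y) := by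
  obtain ⟨X', ⟨e⟩⟩ := hX
  obtain ⟨Y', ⟨e'⟩⟩ := hY
  have := preservesBinaryBiproducts_of_preservesBiproducts j
  exact ⟨X' ⊞ Y', ⟨j.mapBiprod X' Y' ≪≫ biprod.mapIso e e'⟩⟩

lemma essImage_mappingCone_X {K L : CochainComplex A ℤ} (φ : K ⟶ L)
    (hK : ∀ n, j.essImage (K.X n)) (hL : ∀ n, j.essImage (L.X n)) (n : ℤ) :
    j.essImage ((mappingCone φ).X n) :=
  j.essImage.prop_of_iso (homotopyCofiber.XIsoBiprod φ n (n + 1) rfl).symm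
    (essImage_biprod (hK _) (hL _))

-- For `Q` with zero differential, any maps `Q.X (n + 1) ⟶ X.X n` extend to a map from the
-- cone of `𝟙 Q`.
lemma exists_epi_of_forall_exists_epi (hj : ∀ X : A, ∃ (F : E) (p : j.obj F ⟶ X), Epi p)
    (X : CochainComplex A ℤ) :
    ∃ (P : CochainComplex A ℤ) (f : P ⟶ X), (∀ n, j.essImage (P.X n)) ∧ Epi f := by
  choose F p hp using fun n ↦ hj (X.X n)
  let Q : CochainComplex A ℤ :=
    { X n := j.obj (F (n - 1))
      d _ _ := 0 }
  let α : Cochain Q X (-1) := Cochain.mk (fun a b h ↦ p (a - 1) ≫ (X.XIsoOfEq (by lia)).hom)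
  let β : Cocycle Q X 0 := Cocycle.mk (δ (-1) 0 α) 1 rfl (δ_δ _ _ _ _)
  have hαβ : δ (-1) 0 α = Cochain.ofHom (𝟙 Q ≫ β.homOf) := by simp [β]
  refine ⟨mappingCone (𝟙 Q), mappingCone.desc (𝟙 Q) α β.homOf hαβ,
    essImage_mappingCone_X _ (fun _ ↦ j.obj_mem_essImage _) (fun _ ↦ j.obj_mem_essImage _),
    epi_of_epi_f _ fun n ↦ ?_⟩
  have hn : n + 1 + -1 = n := by lia
  have : Epi ((mappingCone.inl (𝟙 Q)).v (n + 1) n hn ≫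
      (mappingCone.desc (𝟙 Q) α β.homOf hαβ).f n) := by
    rw [mappingCone.inl_v_desc_f]
    dsimp only [α, Cochain.mk_v]
    infer_instance
  exact epi_of_epi ((mappingCone.inl (𝟙 Q)).v (n + 1) n hn) _

lemma exists_mono_of_forall_exists_mono (hj : ∀ X : A, ∃ (F : E) (i : X ⟶ j.obj F), Mono i)
    (X : CochainComplex A ℤ) :
    ∃ (I : CochainComplex A ℤ) (f : X ⟶ I), (∀ n, j.essImage (I.X n)) ∧ Mono f := by
  choose F i hi using fun n ↦ hj (X.X n)
  let Q : CochainComplex A ℤ :=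
    { X n := j.obj (F n)
      d _ _ := 0 }
  let β : Cochain X Q 0 := Cochain.ofHoms i
  let α : Cocycle X Q 1 := Cocycle.mk (-δ 0 1 β) 2 rfl (by simp [δ_δ])
  have hαβ : δ 0 1 β + α.1.comp (Cochain.ofHom (𝟙 Q)) (add_zero 1) = 0 := by simp [α]
  refine ⟨mappingCone (𝟙 Q), mappingCone.lift (𝟙 Q) α β hαβ,
    essImage_mappingCone_X _ (fun _ ↦ j.obj_mem_essImage _) (fun _ ↦ j.obj_mem_essImage _),
    mono_of_mono_f _ fun n ↦ ?_⟩
  have : Mono ((mappingCone.lift (𝟙 Q) α β hαβ).f n ≫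
      (mappingCone.snd (𝟙 Q)).v n n (add_zero n)) := by
    rw [mappingCone.lift_f_snd_v, Cochain.ofHoms_v]
    infer_instance
  exact mono_of_mono _ ((mappingCone.snd (𝟙 Q)).v n n (add_zero n))

variable [j.Full] [j.Faithful]

lemma IsCotiltingEmbedding.exists_trW_to (hj : IsCotiltingEmbedding j)
    (X : HomotopyCategory A (.up ℤ)) :
    ∃ (Z : HomotopyCategory E (.up ℤ)) (s : (j.mapHomotopyCategory (.up ℤ)).obj Z ⟶ X),
      (HomotopyCategory.subcategoryAcyclic A).trW s := by
  obtain ⟨X, rfl⟩ := HomotopyCategory.quotient_obj_surjective X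
  obtain ⟨P, f, hP, _⟩ := exists_epi_of_forall_exists_epi hj.exists_epi X
  let S := ShortComplex.mk (kernel.ι f) f (kernel.condition f)
  have hS : S.ShortExact :=
    { exact := ShortComplex.exact_of_f_is_kernel _ (kernelIsKernel f) }
  have := mappingCone.quasiIso_descShortComplex hS
  have hK (n : ℤ) : j.essImage (S.X₁.X n) := by
    have : Mono (S.f.f n) := inferInstanceAs (Mono ((HomologicalComplex.eval A _ n).map S.f))
    exact hj.essImage_of_mono (S.f.f n) (hP n)
  obtain ⟨Z, ⟨e⟩⟩ := essImage_mapHomotopyCategory_quotient_obj (essImage_mappingCone_X S.f hK hP)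
  exact ⟨Z, e.hom ≫ (HomotopyCategory.quotient A _).map (mappingCone.descShortComplex S),
    (MorphismProperty.cancel_left_of_respectsIso _ _ _).2 (trW_subcategoryAcyclic_quotient_map _)⟩

lemma IsTiltingEmbedding.exists_trW_from [HasZeroObject E] (hj : IsTiltingEmbedding j)
    (X : HomotopyCategory A (.up ℤ)) :
    ∃ (Z : HomotopyCategory E (.up ℤ)) (s : X ⟶ (j.mapHomotopyCategory (.up ℤ)).obj Z),
      (HomotopyCategory.subcategoryAcyclic A).trW s := by
  obtain ⟨X, rfl⟩ := HomotopyCategory.quotient_obj_surjective X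
  obtain ⟨I, f, hI, _⟩ := exists_mono_of_forall_exists_mono hj.exists_mono X
  let S := ShortComplex.mk f (cokernel.π f) (cokernel.condition f)
  have hS : S.ShortExact :=
    { exact := ShortComplex.exact_of_g_is_cokernel _ (cokernelIsCokernel f) }
  have := mappingCone.quasiIso_descShortComplex hS
  have hQ (n : ℤ) : j.essImage (S.X₃.X n) := by
    have : Epi (S.g.f n) := inferInstanceAs (Epi ((HomologicalComplex.eval A _ n).map S.g))
    exact hj.essImage_of_epi (S.g.f n) (hI n)
  obtain ⟨Y, s, ⟨Z, ⟨e⟩⟩, hs⟩ := exists_trW_of_distTriang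
    (A := (j.mapHomotopyCategory (.up ℤ)).essImage)
    (HomotopyCategory.mappingCone_triangleh_distinguished S.f)
    (essImage_mapHomotopyCategory_quotient_obj hI)
    (trW_subcategoryAcyclic_quotient_map (mappingCone.descShortComplex S))
    (essImage_mapHomotopyCategory_quotient_obj hQ)
  exact ⟨Z, s ≫ e.inv, (MorphismProperty.cancel_right_of_respectsIso _ _ _).2 hs⟩

variable [HasZeroObject E] [HasDerivedCategory A]

lemma IsCotiltingEmbedding.isLocalization (hj : IsCotiltingEmbedding j) :
    (j.mapHomotopyCategory (.up ℤ) ⋙ DerivedCategory.Qh).IsLocalization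
      ((HomotopyCategory.subcategoryAcyclic A).inverseImage
        (j.mapHomotopyCategory (.up ℤ))).trW :=
  isLocalization_comp_of_exists_trW_to _ _ _ hj.exists_trW_to

lemma IsTiltingEmbedding.isLocalization (hj : IsTiltingEmbedding j) :
    (j.mapHomotopyCategory (.up ℤ) ⋙ DerivedCategory.Qh).IsLocalization
      ((HomotopyCategory.subcategoryAcyclic A).inverseImage
        (j.mapHomotopyCategory (.up ℤ))).trW :=
  isLocalization_comp_of_exists_trW_from _ _ _ hj.exists_trW_from

end Resolution

section Bounded

open DerivedCategory

variable {A : Type*} [Category* A] [Abelian A] [HasDerivedCategory A]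
  (P : ObjectProperty (DerivedCategory A)) [P.IsClosedUnderIsomorphisms]

lemma prop_single_zero_of_essImage {E : Type*} [Category* E] {j : E ⥤ A}
    (hP : ∀ F : E, P ((singleFunctor A 0).obj (j.obj F))) {X : A} (hX : j.essImage X) :
    P ((singleFunctor A 0).obj X) := by
  obtain ⟨F, ⟨e⟩⟩ := hX
  exact P.prop_of_iso ((singleFunctor A 0).mapIso e) (hP F)

variable [P.IsTriangulated]

lemma prop_single_of_prop_single_zero {X : A} (hX : P ((singleFunctor A 0).obj X)) (n : ℤ) :
    P ((singleFunctor A n).obj X) := by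
  have hX' : P (((singleFunctor A n).obj X)⟦n⟧) :=
    P.prop_of_iso (((singleFunctors A).shiftIso n 0 n (by lia)).app X).symm hX
  exact P.prop_of_iso ((shiftEquiv (DerivedCategory A) n).unitIso.app _).symm
    (P.le_shift (-n) _ hX')

lemma prop_of_isGE_of_isLE_of_prop_single (h : ∀ (X : A) (n : ℤ), P ((singleFunctor A n).obj X))
    (a : ℤ) (n : ℕ) (X : DerivedCategory A) [X.IsGE a] [X.IsLE (a + n - 1)] : P X := by
  induction n generalizing X with
  | zero => exact P.prop_of_isZero (TStructure.t.isZero X (a + (0 : ℕ) - 1) a (by lia))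
  | succ n hn =>
    have : X.IsLE (a + n) := TStructure.t.isLE_of_le X (a + (n + 1 : ℕ) - 1) _ (by lia)
    have hLE : P ((TStructure.t.truncLE (a + n - 1)).obj X) := hn _
    have : ((TStructure.t.truncGE (a + n)).obj X).IsLE (a + n) := inferInstance
    obtain ⟨Y, ⟨e⟩⟩ := ((TStructure.t.truncGE (a + n)).obj
      X).exists_iso_singleFunctor_obj_of_isGE_of_isLE (a + n)
    exact P.ext_of_isTriangulatedClosed₂ _
      (TStructure.t.triangleLEGE_distinguished (a + n - 1) (a + n) (by lia) X) hLE
      (P.prop_of_iso e.symm (h Y _))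

lemma bounded_le_of_prop_single_zero (h : ∀ X : A, P ((singleFunctor A 0).obj X)) :
    TStructure.t.bounded ≤ P := by
  rintro X ⟨⟨a, ha⟩, ⟨b, hb⟩⟩
  have : X.IsGE a := ha
  have : X.IsLE (a + (b + 1 - a).toNat - 1) := TStructure.t.isLE_of_le X b _ (by lia)
  exact prop_of_isGE_of_isLE_of_prop_single P
    (fun X ↦ prop_single_of_prop_single_zero P (h X)) a (b + 1 - a).toNat X

variable {P} {E : Type*} [Category* E] {j : E ⥤ A}

lemma IsCotiltingEmbedding.bounded_le (hj : IsCotiltingEmbedding j)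
    (hP : ∀ F : E, P ((singleFunctor A 0).obj (j.obj F))) : TStructure.t.bounded ≤ P := by
  refine bounded_le_of_prop_single_zero P fun X ↦ ?_
  obtain ⟨F, p, _⟩ := hj.exists_epi X
  have hS : (ShortComplex.mk (kernel.ι p) p (kernel.condition p)).ShortExact :=
    { exact := ShortComplex.exact_of_f_is_kernel _ (kernelIsKernel p) }
  exact P.ext_of_isTriangulatedClosed₃ _ hS.singleTriangle_distinguished
    (prop_single_zero_of_essImage P hP
      (hj.essImage_of_mono (kernel.ι p) (j.obj_mem_essImage F))) (hP F)

lemma IsTiltingEmbedding.bounded_le (hj : IsTiltingEmbedding j)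
    (hP : ∀ F : E, P ((singleFunctor A 0).obj (j.obj F))) : TStructure.t.bounded ≤ P := by
  refine bounded_le_of_prop_single_zero P fun X ↦ ?_
  obtain ⟨F, i, _⟩ := hj.exists_mono X
  have hS : (ShortComplex.mk i (cokernel.π i) (cokernel.condition i)).ShortExact :=
    { exact := ShortComplex.exact_of_g_is_cokernel _ (cokernelIsCokernel i) }
  exact P.ext_of_isTriangulatedClosed₁ _ hS.singleTriangle_distinguished (hP F)
    (prop_single_zero_of_essImage P hP
      (hj.essImage_of_epi (cokernel.π i) (j.obj_mem_essImage F)))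

end Bounded

/-- Factorisations `K.X n ⟶ Z n ⟶ K.X (n + 1)` of the differentials of a cochain complex. For an
acyclic complex in an abelian category `Z n` is the image of the differential, i.e. the object of
cycles in degree `n + 1`, and the sequences `Z n ⟶ K.X (n + 1) ⟶ Z (n + 1)` are short exact. -/
structure CycleFactorization {E : Type*} [Category* E] [Preadditive E]
    (K : CochainComplex E ℤ) where
  Z : ℤ → E
  p (n : ℤ) : K.X n ⟶ Z n
  i (n : ℤ) : Z n ⟶ K.X (n + 1)
  fac (n : ℤ) : p n ≫ i n = K.d n (n + 1)
  w (n : ℤ) : i n ≫ p (n + 1) = 0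

section Acyclic

lemma exact_iff_of_epi_of_mono {A : Type*} [Category* A] [Abelian A]
    {X Z Y W V : A} {f : X ⟶ Y} {g : Y ⟶ V} (w : f ≫ g = 0) {i : Z ⟶ Y} {q : Y ⟶ W}
    (w' : i ≫ q = 0) (p : X ⟶ Z) (m : W ⟶ V) [hp : Epi p] [hm : Mono m] (hf : p ≫ i = f)
    (hg : q ≫ m = g) :
    (ShortComplex.mk f g w).Exact ↔ (ShortComplex.mk i q w').Exact := by
  have w'' : i ≫ g = 0 := by rw [← hg, reassoc_of% w', zero_comp]
  let φ : ShortComplex.mk f g w ⟶ ShortComplex.mk i g w'' :=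
    { τ₁ := p, τ₂ := 𝟙 _, τ₃ := 𝟙 _ }
  let ψ : ShortComplex.mk i q w' ⟶ ShortComplex.mk i g w'' :=
    { τ₁ := 𝟙 _, τ₂ := 𝟙 _, τ₃ := m }
  have : Epi φ.τ₁ := hp
  have : IsIso φ.τ₂ := inferInstanceAs (IsIso (𝟙 _))
  have : Mono φ.τ₃ := inferInstanceAs (Mono (𝟙 _))
  have : Epi ψ.τ₁ := inferInstanceAs (Epi (𝟙 _))
  have : IsIso ψ.τ₂ := inferInstanceAs (IsIso (𝟙 _))
  have : Mono ψ.τ₃ := hm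
  exact (ShortComplex.exact_iff_of_epi_of_isIso_of_mono φ).trans
    (ShortComplex.exact_iff_of_epi_of_isIso_of_mono ψ).symm

variable {E A : Type*} [Category* E] [Preadditive E] [Category* A] [Abelian A]
  (j : E ⥤ A) {K : CochainComplex E ℤ}

lemma exists_cycleFactorization [j.Full] [j.Faithful]
    (hj : ∀ ⦃X Y : E⦄ (f : X ⟶ Y), j.essImage (Abelian.image (j.map f)))
    (K : CochainComplex E ℤ) :
    ∃ φ : CycleFactorization K, ∀ n, Epi (j.map (φ.p n)) ∧ Mono (j.map (φ.i n)) := by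
  have hfac (n : ℤ) : ∃ (Z : E) (p : K.X n ⟶ Z) (i : Z ⟶ K.X (n + 1)),
      p ≫ i = K.d n (n + 1) ∧ Epi (j.map p) ∧ Mono (j.map i) := by
    obtain ⟨Z, ⟨e⟩⟩ := hj (K.d n (n + 1))
    refine ⟨Z, j.preimage (Abelian.factorThruImage _ ≫ e.inv),
      j.preimage (e.hom ≫ Abelian.image.ι _), j.map_injective (by simp), ?_, ?_⟩ <;>
    · rw [j.map_preimage]
      infer_instance
  choose Z p i fac hp hi using hfac
  have w (n : ℤ) : i n ≫ p (n + 1) = 0 := by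
    apply j.map_injective
    rw [← cancel_epi (j.map (p n)), ← cancel_mono (j.map (i (n + 1)))]
    simp only [← j.map_comp, Category.assoc, fac, reassoc_of% (fac n), K.d_comp_d,
      zero_comp, comp_zero]
  exact ⟨⟨Z, p, i, fac, w⟩, fun n ↦ ⟨hp n, hi n⟩⟩

variable [j.Additive]

namespace CycleFactorization

/-- The sequence `Z n ⟶ K.X (n + 1) ⟶ Z (n + 1)`. -/
@[simps]
def shortComplex (φ : CycleFactorization K) (n : ℤ) : ShortComplex E :=
  .mk (φ.i n) (φ.p (n + 1)) (φ.w n)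

lemma exactAt_iff (φ : CycleFactorization K) (n : ℤ)
    [hp : Epi (j.map (φ.p n))] [hm : Mono (j.map (φ.i (n + 1)))] :
    ((j.mapHomologicalComplex (.up ℤ)).obj K).ExactAt (n + 1) ↔
      ((φ.shortComplex n).map j).Exact :=
  (HomologicalComplex.exactAt_iff' _ n (n + 1) (n + 1 + 1) (by simp) (by simp)).trans
    (exact_iff_of_epi_of_mono _ _ (j.map (φ.p n)) (j.map (φ.i (n + 1))) (hp := hp) (hm := hm)
      ((j.map_comp _ _).symm.trans (congrArg j.map (φ.fac _)))
      ((j.map_comp _ _).symm.trans (congrArg j.map (φ.fac _))))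

lemma acyclic_of_shortExact (φ : CycleFactorization K)
    (hφ : ∀ n, ((φ.shortComplex n).map j).ShortExact) :
    ((j.mapHomologicalComplex (.up ℤ)).obj K).Acyclic := fun m ↦ by
  obtain ⟨n, rfl⟩ : ∃ n, m = n + 1 + 1 := ⟨m - 2, by lia⟩
  have : Epi (j.map (φ.p (n + 1))) := (hφ n).epi_g
  have : Mono (j.map (φ.i (n + 1 + 1))) := (hφ (n + 1 + 1)).mono_f
  exact (φ.exactAt_iff j (n + 1)).2 (hφ (n + 1)).exact

end CycleFactorization

variable [j.Full] [j.Faithful]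

lemma acyclic_iff_exists_cycleFactorization
    (hj : ∀ ⦃X Y : E⦄ (f : X ⟶ Y), j.essImage (Abelian.image (j.map f))) :
    ((j.mapHomologicalComplex (.up ℤ)).obj K).Acyclic ↔
      ∃ φ : CycleFactorization K, ∀ n, ((φ.shortComplex n).map j).ShortExact := by
  refine ⟨fun hK ↦ ?_, fun ⟨φ, hφ⟩ ↦ φ.acyclic_of_shortExact j hφ⟩
  obtain ⟨φ, hφ⟩ := exists_cycleFactorization j hj K
  have (n : ℤ) : Epi (j.map (φ.p n)) := (hφ n).1
  have (n : ℤ) : Mono (j.map (φ.i n)) := (hφ n).2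
  exact ⟨φ, fun n ↦
    { exact := (φ.exactAt_iff j n).1 (hK (n + 1))
      mono_f := inferInstanceAs (Mono (j.map (φ.i n)))
      epi_g := inferInstanceAs (Epi (j.map (φ.p (n + 1)))) }⟩

lemma inverseImage_subcategoryAcyclic_eq {A' : Type*} [Category* A'] [Abelian A']
    (j' : E ⥤ A') [j'.Additive] [j'.Full] [j'.Faithful]
    (hj : ∀ ⦃X Y : E⦄ (f : X ⟶ Y), j.essImage (Abelian.image (j.map f)))
    (hj' : ∀ ⦃X Y : E⦄ (f : X ⟶ Y), j'.essImage (Abelian.image (j'.map f)))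
    (h : ∀ S : ShortComplex E, (S.map j).ShortExact ↔ (S.map j').ShortExact) :
    (HomotopyCategory.subcategoryAcyclic A).inverseImage (j.mapHomotopyCategory (.up ℤ)) =
      (HomotopyCategory.subcategoryAcyclic A').inverseImage
        (j'.mapHomotopyCategory (.up ℤ)) := by
  ext K
  obtain ⟨K, rfl⟩ := HomotopyCategory.quotient_obj_surjective K
  calc
    _ ↔ ((j.mapHomologicalComplex (.up ℤ)).obj K).Acyclic :=
      HomotopyCategory.quotient_obj_mem_subcategoryAcyclic_iff_acyclic _
    _ ↔ ((j'.mapHomologicalComplex (.up ℤ)).obj K).Acyclic := by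
      simp only [acyclic_iff_exists_cycleFactorization, hj, hj', h, implies_true]
    _ ↔ _ := (HomotopyCategory.quotient_obj_mem_subcategoryAcyclic_iff_acyclic _).symm

end Acyclic

section GeneralTheorem

open DerivedCategory

variable {E A : Type*} [Category* E] [Preadditive E] [Category* A] [Abelian A]
  [HasDerivedCategory A] (j : E ⥤ A) [j.Additive]

/-- The passage from complexes over `E` to `D(A)` factors through the homotopy category of `E`. -/
noncomputable def mapHomologicalComplexCompQIso :
    j.mapHomologicalComplex (.up ℤ) ⋙ Q ≅
      HomotopyCategory.quotient E (.up ℤ) ⋙ j.mapHomotopyCategory (.up ℤ) ⋙ Qh :=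
  Functor.isoWhiskerLeft _ (quotientCompQhIso A).symm ≪≫
    Functor.isoWhiskerRight (j.mapHomotopyCategoryFactors (.up ℤ)).symm Qh

variable [HasZeroObject E]

/-- In `D(A)`, the complex over `E` with the single term `F` in degree `0` becomes `j F` placed in
degree `0`. -/
noncomputable def mapHomologicalComplexSingleIso (F : E) :
    Q.obj ((j.mapHomologicalComplex (.up ℤ)).obj
      ((HomologicalComplex.single E (.up ℤ) 0).obj F)) ≅ (singleFunctor A 0).obj (j.obj F) :=
  Q.mapIso ((HomologicalComplex.singleMapHomologicalComplex j (.up ℤ) 0).app F)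

variable {j} {A' : Type*} [Category* A'] [Abelian A'] [HasDerivedCategory A']
  {j' : E ⥤ A'} [j'.Additive]

lemma bounded_obj_singleFunctor_of_iso {Φ : DerivedCategory A ⥤ DerivedCategory A'}
    (e : j.mapHomologicalComplex (.up ℤ) ⋙ Q ⋙ Φ ≅ j'.mapHomologicalComplex (.up ℤ) ⋙ Q)
    (F : E) : TStructure.t.bounded (Φ.obj ((singleFunctor A 0).obj (j.obj F))) :=
  TStructure.t.bounded.prop_of_iso
    ((mapHomologicalComplexSingleIso j' F).symm ≪≫ (e.app _).symm ≪≫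
      Φ.mapIso (mapHomologicalComplexSingleIso j F))
    ⟨⟨0, inferInstance⟩, ⟨0, inferInstance⟩⟩

/-- A natural isomorphism `Φ(K) ≅ K` for `K` in the homotopy category of `E`, restated for `K` a
complex over `E`. -/
noncomputable def mapHomologicalComplexCompQIsoOfIso
    {Φ : DerivedCategory A ⥤ DerivedCategory A'}
    (e : (j.mapHomotopyCategory (.up ℤ) ⋙ Qh) ⋙ Φ ≅ j'.mapHomotopyCategory (.up ℤ) ⋙ Qh) :
    j.mapHomologicalComplex (.up ℤ) ⋙ Q ⋙ Φ ≅ j'.mapHomologicalComplex (.up ℤ) ⋙ Q :=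
  Functor.isoWhiskerRight (mapHomologicalComplexCompQIso j) Φ ≪≫
    Functor.isoWhiskerLeft (HomotopyCategory.quotient _ (.up ℤ)) e ≪≫
    (mapHomologicalComplexCompQIso j').symm

theorem exists_triangulated_equivalence_of_isTiltingEmbedding [HasBinaryBiproducts E]
    [j.Full] [j.Faithful] [j'.Full] [j'.Faithful] (hj : IsTiltingEmbedding j)
    (hj' : IsCotiltingEmbedding j')
    (h : ∀ S : ShortComplex E, (S.map j).ShortExact ↔ (S.map j').ShortExact) :
    ∃ (Φ : DerivedCategory A ≌ DerivedCategory A') (_ : Φ.functor.CommShift ℤ)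
      (Φb : Bounded A ≌ Bounded A') (_ : Φb.functor.CommShift ℤ),
      Φ.functor.IsTriangulated ∧ Φb.functor.IsTriangulated ∧
      Nonempty (Φb.functor ⋙ Bounded.ι ≅ Bounded.ι ⋙ Φ.functor) ∧
      Nonempty (j.mapHomologicalComplex (.up ℤ) ⋙ Q ⋙ Φ.functor ≅
        j'.mapHomologicalComplex (.up ℤ) ⋙ Q) := by
  have hL := hj.isLocalization
  have hL' := hj'.isLocalization
  rw [← inverseImage_subcategoryAcyclic_eq j j'
    (fun _ _ f ↦ hj.essImage_of_epi (Abelian.factorThruImage (j.map f)) (j.obj_mem_essImage _))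
    (fun _ _ f ↦ hj'.essImage_of_mono (Abelian.image.ι (j'.map f)) (j'.obj_mem_essImage _))
    h] at hL'
  obtain ⟨Φ, _, _, hΦ, _, ⟨e⟩, ⟨e'⟩⟩ := exists_triangulated_equivalence_of_isLocalization
    ((HomotopyCategory.subcategoryAcyclic A).inverseImage (j.mapHomotopyCategory (.up ℤ)))
    (j.mapHomotopyCategory (.up ℤ) ⋙ Qh) (j'.mapHomotopyCategory (.up ℤ) ⋙ Qh)
  let u := mapHomologicalComplexCompQIsoOfIso e
  obtain ⟨Φb, _, hΦb, hι⟩ := exists_triangulated_restriction Φ TStructure.t.bounded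
    TStructure.t.bounded (hj.bounded_le (bounded_obj_singleFunctor_of_iso u))
    (hj'.bounded_le (bounded_obj_singleFunctor_of_iso (mapHomologicalComplexCompQIsoOfIso e')))
  exact ⟨Φ, inferInstance, Φb, inferInstance, hΦ, hΦb, hι, ⟨u⟩⟩

end GeneralTheorem

section Pretriangulated

variable {D : Type*} [Category* D] [HasZeroObject D] [HasShift D ℤ] [Preadditive D]
  [∀ n : ℤ, (shiftFunctor D n).Additive] [Pretriangulated D]

lemma distTriang_of_iso₃ {X Y Z Z' : D} {f : X ⟶ Y} {g : Y ⟶ Z} {h : Z ⟶ X⟦(1 : ℤ)⟧}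
    (hT : Triangle.mk f g h ∈ distTriang D) (e : Z ≅ Z') :
    Triangle.mk f (g ≫ e.hom) (e.inv ≫ h) ∈ distTriang D :=
  isomorphic_distinguished _ hT _ (Triangle.isoMk _ _ (Iso.refl X) (Iso.refl Y) e.symm
    (show f ≫ 𝟙 Y = 𝟙 X ≫ f by simp) (show (g ≫ e.hom) ≫ e.inv = 𝟙 Y ≫ g by simp)
    (show (e.inv ≫ h) ≫ (𝟙 X)⟦(1 : ℤ)⟧' = e.inv ≫ h by simp))

end Pretriangulated

section AbelianSubcategory

variable {H D : Type*} [Category* H] [Abelian H] [Category* D] [HasZeroObject D] [HasShift D ℤ]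
  [Preadditive D] [∀ n : ℤ, (shiftFunctor D n).Additive] [Pretriangulated D]
  {ι : H ⥤ D} [ι.Full] [ι.Faithful]
  (hι : ∀ ⦃X Y : H⦄ ⦃n : ℤ⦄ (f : ι.obj X ⟶ (ι.obj Y)⟦n⟧), n < 0 → f = 0)
include hι

lemma shortExact_of_distTriang [ι.Additive] (S : ShortComplex H)
    (δ : ι.obj S.X₃ ⟶ (ι.obj S.X₁)⟦(1 : ℤ)⟧)
    (hT : Triangle.mk (ι.map S.f) (ι.map S.g) δ ∈ distTriang D) : S.ShortExact :=
  have hf := AbelianSubcategory.isLimitKernelForkOfDistTriang hι S.f S.g δ hT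
  have hg := AbelianSubcategory.isColimitCokernelCoforkOfDistTriang hι S.f S.g δ hT
  { exact := ShortComplex.exact_of_f_is_kernel _ hf
    mono_f := ⟨fun _ _ h ↦ Fork.IsLimit.hom_ext hf h⟩
    epi_g := ⟨fun _ _ h ↦ Cofork.IsColimit.hom_ext hg h⟩ }

lemma exists_distTriang_of_shortExact [ι.Additive]
    (hι' : AbelianSubcategory.admissibleMorphism ι = ⊤) {S : ShortComplex H}
    (hS : S.ShortExact) :
    ∃ δ : ι.obj S.X₃ ⟶ (ι.obj S.X₁)⟦(1 : ℤ)⟧,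
      Triangle.mk (ι.map S.f) (ι.map S.g) δ ∈ distTriang D := by
  have := hS.epi_g
  have := hS.mono_f
  obtain ⟨X₁, i, δ, hT⟩ := AbelianSubcategory.exists_distinguished_triangle_of_epi hι hι' S.g
  let e : S.X₁ ≅ X₁ := hS.exact.fIsKernel.conePointUniqueUpToIso
    (AbelianSubcategory.isLimitKernelForkOfDistTriang hι i S.g δ hT)
  have he : e.hom ≫ i = S.f :=
    IsLimit.conePointUniqueUpToIso_hom_comp _ _ WalkingParallelPair.zero
  have hT' := TStructure.distTriang_of_iso₁ hT (ι.mapIso e)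
  rw [Functor.mapIso_hom, ← ι.map_comp, he] at hT'
  exact ⟨_, hT'⟩

end AbelianSubcategory

section Homology

open DerivedCategory

variable {A : Type*} [Category* A] [Abelian A]

lemma epi_homologyMap_of_epi_f {K L : CochainComplex A ℤ} (f : K ⟶ L) (n : ℤ)
    [K.IsStrictlyLE n] [L.IsStrictlyLE n] [Epi (f.f n)] :
    Epi (HomologicalComplex.homologyMap f n) := by
  have h (M : CochainComplex A ℤ) [M.IsStrictlyLE n] : IsIso (M.iCycles n) :=
    M.isIso_iCycles n (n + 1) (by simp)
      ((M.isZero_of_isStrictlyLE n (n + 1) (by lia)).eq_of_tgt _ _)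
  have := h K
  have := h L
  have : Epi (HomologicalComplex.cyclesMap f n) := by
    have : HomologicalComplex.cyclesMap f n = K.iCycles n ≫ f.f n ≫ inv (L.iCycles n) := by
      rw [← HomologicalComplex.cyclesMap_i_assoc, IsIso.hom_inv_id, Category.comp_id]
    rw [this]
    infer_instance
  have : Epi (K.homologyπ n ≫ HomologicalComplex.homologyMap f n) := by
    rw [HomologicalComplex.homologyπ_naturality]
    infer_instance
  exact epi_of_epi (K.homologyπ n) _

variable [HasDerivedCategory A]

lemma single_hom_shift_eq_zero ⦃X Y : A⦄ ⦃n : ℤ⦄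
    (f : (singleFunctor A 0).obj X ⟶ ((singleFunctor A 0).obj Y)⟦n⟧) (hn : n < 0) : f = 0 := by
  have hY : TStructure.t.IsGE (((singleFunctor A 0).obj Y)⟦n⟧) (-n) :=
    TStructure.t.isGE_shift _ 0 n (-n)
  exact TStructure.t.zero_of_isLE_of_isGE f 0 (-n) (by lia) inferInstance hY

lemma isLE_of_distTriang_of_epi_homologyMap {X Y Z : DerivedCategory A} {f : X ⟶ Y} {g : Y ⟶ Z}
    {h : Z ⟶ X⟦(1 : ℤ)⟧} (hT : Triangle.mk f g h ∈ distTriang _) (n : ℤ)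
    [X.IsLE (n + 1)] [hY : Y.IsLE (n + 1)] [hf : Epi ((homologyFunctor A (n + 1)).map f)] :
    Z.IsLE n := by
  have : (X⟦(1 : ℤ)⟧).IsLE n := TStructure.t.isLE_shift X (n + 1) 1 n
  have hX : (X⟦(1 : ℤ)⟧).IsLE (n + 1) := TStructure.t.isLE_of_le _ n (n + 1)
  have : Z.IsLE (n + 1) := TStructure.t.isLE₂ _ (rot_of_distTriang _ hT) (n + 1) hY hX
  have hg : (homologyFunctor A (n + 1)).map g = 0 :=
    (HomologySequence.epi_homologyMap_mor₁_iff _ hT (n + 1)).1 hf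
  have : Epi ((homologyFunctor A (n + 1)).map g) :=
    (HomologySequence.epi_homologyMap_mor₂_iff _ hT (n + 1) (n + 1 + 1) rfl).2
      ((isZero_of_isLE X (n + 1) (n + 1 + 1) (by lia)).eq_of_tgt _ _)
  rw [isLE_iff]
  intro i hi
  obtain rfl | hi : i = n + 1 ∨ n + 1 < i := by lia
  · exact IsZero.of_epi_eq_zero _ hg
  · exact isZero_of_isLE Z (n + 1) i hi

end Homology

namespace TorsionPair

open DerivedCategory

variable {C : Type u} [Category.{v} C] [Abelian C] (τ : TorsionPair C)

lemma free_of_hom_eq_zero {X : C} (h : ∀ ⦃T : C⦄ (_ : τ.tors T) (f : T ⟶ X), f = 0) :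
    τ.free X := by
  obtain ⟨S, e, hS, h₁, h₃⟩ := τ.exists_shortExact X
  have hf : S.f = 0 := by
    rw [← cancel_mono e.hom, zero_comp]
    exact h h₁ _
  have := hS.epi_g
  have := hS.exact.mono_g hf
  have := isIso_of_mono_of_epi S.g
  exact τ.free.prop_of_iso ((asIso S.g).symm ≪≫ e) h₃

lemma free_of_mono {X Y : C} (i : X ⟶ Y) [Mono i] (hY : τ.free Y) : τ.free X :=
  τ.free_of_hom_eq_zero fun T hT f ↦ by
    rw [← cancel_mono i, zero_comp]
    exact τ.hom_eq_zero hT hY _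

instance : τ.free.ContainsZero := ⟨0, isZero_zero C, τ.free_of_isZero (isZero_zero C)⟩

instance : τ.free.IsClosedUnderBinaryProducts := ⟨by
  rintro X ⟨p⟩
  refine τ.free_of_hom_eq_zero fun T hT f ↦ p.isLimit.hom_ext fun j ↦ ?_
  rw [zero_comp, τ.hom_eq_zero hT (p.prop_diag_obj j) (f ≫ _)]⟩

instance : HasBinaryBiproducts τ.free.FullSubcategory :=
  have : τ.free.IsClosedUnderFiniteProducts := .mk'
  have : HasFiniteProducts τ.free.FullSubcategory := ⟨fun _ ↦ inferInstance⟩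
  HasBinaryBiproducts.of_hasBinaryProducts

variable {τ} in
lemma IsCotilting.isCotiltingEmbedding (hτ : τ.IsCotilting) :
    IsCotiltingEmbedding τ.free.ι where
  exists_epi X := by
    obtain ⟨F, hF, p, hp⟩ := hτ X
    exact ⟨⟨F, hF⟩, p, hp⟩
  essImage_of_mono X Y i _ := fun ⟨F, ⟨e⟩⟩ ↦
    ⟨⟨X, τ.free_of_mono i (τ.free.prop_of_iso e F.property)⟩, ⟨Iso.refl _⟩⟩

variable [HasDerivedCategory.{w} C]

/-- The inclusion of the tilt in the unbounded derived category. -/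
noncomputable abbrev tiltι : τ.Tilt ⥤ DerivedCategory C :=
  τ.boundedTStructure.heart.ι ⋙ Bounded.ι

lemma le_tiltι_obj (X : τ.Tilt) : τ.le 0 (τ.tiltι.obj X) := X.property.1

lemma ge_tiltι_obj (X : τ.Tilt) : τ.ge 0 (τ.tiltι.obj X) := X.property.2

lemma tiltι_hom_shift_eq_zero ⦃X Y : τ.Tilt⦄ ⦃n : ℤ⦄
    (f : τ.tiltι.obj X ⟶ (τ.tiltι.obj Y)⟦n⟧) (hn : n < 0) : f = 0 :=
  τ.tStructure.zero_of_isLE_of_isGE f 0 (-n) (by lia) ⟨τ.le_tiltι_obj X⟩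
    ⟨τ.ge_shift 0 n (-n) (by lia) _ (τ.ge_tiltι_obj Y)⟩

lemma exists_tiltι_distTriang {S : ShortComplex τ.Tilt} (hS : S.ShortExact) :
    ∃ δ : τ.tiltι.obj S.X₃ ⟶ (τ.tiltι.obj S.X₁)⟦(1 : ℤ)⟧,
      Triangle.mk (τ.tiltι.map S.f) (τ.tiltι.map S.g) δ ∈ distTriang _ := by
  obtain ⟨δ, hT⟩ := exists_distTriang_of_shortExact τ.boundedTStructure.heart_hom_shift_eq_zero
    τ.boundedTStructure.heart_admissibleMorphism hS
  exact ⟨_, Bounded.ι.map_distinguished _ hT⟩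

lemma shortExact_map_freeToTilt_iff (S : ShortComplex τ.free.FullSubcategory) :
    (S.map τ.freeToTilt).ShortExact ↔ (S.map τ.free.ι).ShortExact := by
  refine ⟨fun hS ↦ ?_, fun hS ↦ ?_⟩
  · obtain ⟨δ, hT⟩ := τ.exists_tiltι_distTriang hS
    exact shortExact_of_distTriang single_hom_shift_eq_zero (S.map τ.free.ι) δ hT
  · exact shortExact_of_distTriang τ.tiltι_hom_shift_eq_zero (S.map τ.freeToTilt) hS.singleδ
      hS.singleTriangle_distinguished

instance : τ.freeToTilt.Full where
  map_surjective f := by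
    obtain ⟨g, hg⟩ := (singleFunctor C 0).map_surjective (τ.tiltι.map f)
    exact ⟨τ.free.homMk g, τ.tiltι.map_injective hg⟩

instance : τ.freeToTilt.Faithful where
  map_injective h := τ.free.ι.map_injective ((singleFunctor C 0).map_injective
    (τ.tiltι.congr_map h))

lemma essImage_freeToTilt_iff (Y : τ.Tilt) :
    τ.freeToTilt.essImage Y ↔ (τ.tiltι.obj Y).IsLE 0 := by
  refine ⟨fun ⟨F, ⟨e⟩⟩ ↦ ?_, fun hY ↦ ?_⟩
  · have : (τ.tiltι.obj (τ.freeToTilt.obj F)).IsLE 0 :=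
      inferInstanceAs (((singleFunctor C 0).obj F.obj).IsLE 0)
    exact TStructure.t.isLE_of_iso (τ.tiltι.mapIso e) 0
  · obtain ⟨F, hF, ⟨e⟩⟩ := τ.exists_iso_single_of_ge (τ.ge_tiltι_obj Y) hY
    exact ⟨⟨F, hF⟩, ⟨τ.tiltι.preimageIso e.symm⟩⟩

lemma essImage_freeToTilt_of_epi ⦃X Y : τ.Tilt⦄ (p : X ⟶ Y) [Epi p]
    (hX : τ.freeToTilt.essImage X) : τ.freeToTilt.essImage Y := by
  have hS : (ShortComplex.mk (kernel.ι p) p (kernel.condition p)).ShortExact :=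
    { exact := ShortComplex.exact_of_f_is_kernel _ (kernelIsKernel p) }
  obtain ⟨δ, hT⟩ := τ.exists_tiltι_distTriang hS
  rw [essImage_freeToTilt_iff] at hX ⊢
  have hK : (τ.tiltι.obj (kernel p)).IsLE 1 := τ.isLE_of_le (τ.le_tiltι_obj _)
  have hK' : ((τ.tiltι.obj (kernel p))⟦(1 : ℤ)⟧).IsLE 0 := TStructure.t.isLE_shift _ 1 1 0
  exact TStructure.t.isLE₂ _ (rot_of_distTriang _ hT) 0 hX hK'

variable {τ}

lemma mono_of_distTriang {X : DerivedCategory C} {Y Z : τ.Tilt} {f : X ⟶ τ.tiltι.obj Y}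
    {i : Y ⟶ Z} {h : τ.tiltι.obj Z ⟶ X⟦(1 : ℤ)⟧}
    (hT : Triangle.mk f (τ.tiltι.map i) h ∈ distTriang _) (hX : τ.ge 1 X) : Mono i := by
  refine Preadditive.mono_of_cancel_zero _ fun {W} k hk ↦ τ.tiltι.map_injective ?_
  obtain ⟨l, hl⟩ := Triangle.coyoneda_exact₂ _ hT (τ.tiltι.map k)
    ((τ.tiltι.map_comp k i).symm.trans ((τ.tiltι.congr_map hk).trans (τ.tiltι.map_zero _ _)))
  rw [τ.hom_eq_zero_of_le_of_ge l (τ.le_tiltι_obj W) hX, zero_comp] at hl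
  exact hl.trans (τ.tiltι.map_zero _ _).symm

namespace IsCotilting

variable (hτ : τ.IsCotilting)
include hτ

lemma exists_single_hom_epi_homologyMap (X : DerivedCategory C) (n : ℤ) [X.IsLE n] :
    ∃ (B : C) (_ : τ.free B) (f : (singleFunctor C n).obj B ⟶ X),
      Epi ((homologyFunctor C n).map f) := by
  obtain ⟨K, _, ⟨e⟩⟩ := X.exists_iso_Q_obj_of_isLE n
  obtain ⟨B, hB, p, _⟩ := hτ (K.X n)
  let φ : (HomologicalComplex.single C (.up ℤ) n).obj B ⟶ K :=
    HomologicalComplex.mkHomFromSingle p fun k hk ↦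
      (K.isZero_of_isStrictlyLE n k (by rw [ComplexShape.up_Rel] at hk; lia)).eq_of_tgt _ _
  have : Epi (φ.f n) := by
    rw [HomologicalComplex.mkHomFromSingle_f]
    infer_instance
  have : Epi ((homologyFunctor C n).map (Q.map φ)) :=
    ((MorphismProperty.epimorphisms C).arrow_mk_iso_iff
      (Arrow.isoOfNatIso (homologyFunctorFactors C n) (Arrow.mk φ))).2
      (epi_homologyMap_of_epi_f φ n)
  have h : Epi ((homologyFunctor C n).map (Q.map φ) ≫ (homologyFunctor C n).map e.inv) :=
    epi_comp _ _
  rw [← Functor.map_comp] at h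
  exact ⟨B, hB, _, h⟩

-- Choose `B` torsion-free and `f : B[-1] ⟶ Y` onto `H¹(Y)`. The cone of `f` is torsion-free, placed
-- in degree `0`, and `Y ⟶ cone f` is a monomorphism as `B[-1]` lies in `ᵖD^{≥ 1}`.
lemma exists_mono_freeToTilt (Y : τ.Tilt) :
    ∃ (F : τ.free.FullSubcategory) (i : Y ⟶ τ.freeToTilt.obj F), Mono i := by
  have : (τ.tiltι.obj Y).IsLE (0 + 1) := τ.isLE_of_le (τ.le_tiltι_obj Y)
  obtain ⟨B, hB, f, _⟩ := hτ.exists_single_hom_epi_homologyMap (τ.tiltι.obj Y) (0 + 1)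
  obtain ⟨A, g, h, hT⟩ := distinguished_cocone_triangle f
  have hB₁ : τ.ge 1 ((singleFunctor C (0 + 1)).obj B) := τ.ge_single hB
  have hA : τ.ge 0 A := (τ.tStructure.isGE₂ _ (rot_of_distTriang _ hT) 0 ⟨τ.ge_tiltι_obj Y⟩
    ⟨τ.ge_shift 1 1 0 (by lia) _ hB₁⟩).ge
  have hA' : A.IsLE 0 := isLE_of_distTriang_of_epi_homologyMap hT 0
  obtain ⟨F, hF, ⟨e⟩⟩ := τ.exists_iso_single_of_ge hA hA'
  let u : A ≅ τ.tiltι.obj (τ.freeToTilt.obj ⟨F, hF⟩) := e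
  obtain ⟨i, hi⟩ := τ.tiltι.map_surjective (g ≫ u.hom)
  have hT' := distTriang_of_iso₃ hT u
  rw [← hi] at hT'
  exact ⟨⟨F, hF⟩, i, mono_of_distTriang hT' hB₁⟩

lemma isTiltingEmbedding : IsTiltingEmbedding τ.freeToTilt where
  exists_mono := hτ.exists_mono_freeToTilt
  essImage_of_epi := τ.essImage_freeToTilt_of_epi

end IsCotilting

end TorsionPair

theorem mainTheorem11 {C : Type u} [Category.{v} C] [Abelian C] [HasDerivedCategory.{w} C]
    (τ : TorsionPair C) [HasDerivedCategory.{w'} τ.Tilt] (hτ : τ.IsCotilting) :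
    ∃ (Φ : DerivedCategory τ.Tilt ≌ DerivedCategory C)
      (_ : Φ.functor.CommShift ℤ)
      (Φb : DerivedCategory.Bounded τ.Tilt ≌ DerivedCategory.Bounded C)
      (_ : Φb.functor.CommShift ℤ),
      Φ.functor.IsTriangulated ∧ Φb.functor.IsTriangulated ∧
      Nonempty (Φb.functor ⋙ DerivedCategory.Bounded.ι ≅
        DerivedCategory.Bounded.ι ⋙ Φ.functor) ∧
      Nonempty (τ.freeToTilt.mapHomologicalComplex (ComplexShape.up ℤ) ⋙
          DerivedCategory.Q ⋙ Φ.functor ≅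
        τ.free.ι.mapHomologicalComplex (ComplexShape.up ℤ) ⋙ DerivedCategory.Q) := by
  have hj := hτ.isTiltingEmbedding
  have hj' := hτ.isCotiltingEmbedding
  exact exists_triangulated_equivalence_of_isTiltingEmbedding hj hj'
    τ.shortExact_map_freeToTilt_iff
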